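/- Let $n\ge 1$ and let $s_1,\dots,s_n$ be independent random variables, each uniformly distributed on $\{1,2,\dots,n\}$. The algorithm BACKWARD tests whether $s_1,\dots,s_n$ are pairwise different: for $i=2,3,\dots,n$ and, for each $i$, for $j=i-1,i-2,\dots,1$, it compares $s_i$ with $s_j$; as soon as $s_i=s_j$ it stops with output FALSE, and if this never happens its output is TRUE. Let $C_W=C_W(n)$ be the expected number of comparisons $s_i=s_j$ that BACKWARD makes, and put $$\kappa(n)=\frac13-\sqrt{\frac{\pi n}{2}}+\sum_{k=1}^{n}\frac{n!\,k^2}{(n-k)!\,n^{k+1}},\qquad \alpha(n)=\frac{\kappa(n)}{2}+\frac{n!}{n^n}\,\frac{n+1}{2}.$$ Then, for every $n\ge1$, $$C_W=n-\sqrt{\frac{\pi n}{8}}+\frac23-\frac12\kappa(n)-\frac{n!}{n^n}\,\frac{n+1}{2}=n-\sqrt{\frac{\pi n}{8}}+\frac23-\alpha(n),$$ and $\alpha(n)$ is strictly decreasing in $n\ge 1$ and tends to $0$ as $n\to\infty$. -/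

import Mathlib

open MeasureTheory ProbabilityTheory Filter Topology

namespace LatinTest

/-- The inner loop of `BACKWARD` for a fixed `i`: for `j, j - 1, …, 1` (in this order) the
comparison `s i = s j` is made, and the loop stops as soon as one of them succeeds. The result is
the pair (whether a repetition was found, number of comparisons made). -/
def backwardInner (s : ℕ → ℕ) (i : ℕ) : ℕ → Bool × ℕ
  | 0 => (false, 0)
  | j + 1 =>
    if s i = s (j + 1) then (true, 1)
    else ((backwardInner s i j).1, 1 + (backwardInner s i j).2)

/-- The outer loop of `BACKWARD`, with `m` values `i, i + 1, …, i + m - 1` of the loop variable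
still to be treated. For each of them the inner loop runs through `j = i - 1, …, 1`, and the
algorithm returns `false` as soon as a repetition is found, and `true` if there is none. The result
is the pair (output, number of comparisons made). -/
def backwardOuter (s : ℕ → ℕ) : ℕ → ℕ → Bool × ℕ
  | 0, _ => (true, 0)
  | m + 1, i =>
    if (backwardInner s i (i - 1)).1 = true then (false, (backwardInner s i (i - 1)).2)
    else ((backwardOuter s m (i + 1)).1,
      (backwardInner s i (i - 1)).2 + (backwardOuter s m (i + 1)).2)

/-- `BACKWARD(n, s)` on the input sequence `(s 1, …, s n)`: the outer loop runs through the
`n - 1` values `i = 2, …, n`. Entries of `s` outside `{1, …, n}` are never read. The result is the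
pair (output, number of comparisons of elements of the sequence). -/
def backward (n : ℕ) (s : ℕ → ℕ) : Bool × ℕ := backwardOuter s (n - 1) 2

/-- The number of comparisons between elements of `(s 1, …, s n)` made by `BACKWARD`. -/
def backwardComparisons (n : ℕ) (s : ℕ → ℕ) : ℕ := (backward n s).2

/-- `x 1, …, x n` are independent random variables on `(Ω, μ)`, each of them uniformly distributed
on `{1, …, n}`. -/
structure IsUniformInput {Ω : Type*} [MeasurableSpace Ω] (μ : Measure Ω) (n : ℕ)
    (x : ℕ → Ω → ℕ) : Prop where
  measurable : ∀ i ∈ Finset.Icc 1 n, Measurable (x i)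
  indep : iIndepFun (fun i : Finset.Icc 1 n => x i) μ
  uniform : ∀ i ∈ Finset.Icc 1 n, μ.map (x i) = uniformOn (Set.Icc 1 n)

/-- `κ(n) = 1/3 - √(πn/2) + ∑_{k=1}^n n! k² / ((n-k)! n^{k+1})`. -/
noncomputable def kappa (n : ℕ) : ℝ :=
  1 / 3 - Real.sqrt (Real.pi * n / 2)
    + ∑ k ∈ Finset.Icc 1 n,
        ((n.factorial : ℝ) * (k : ℝ) ^ 2) / (((n - k).factorial : ℝ) * (n : ℝ) ^ (k + 1))

/-- `α(n) = κ(n)/2 + (n!/n^n) (n+1)/2`. -/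
noncomputable def alpha (n : ℕ) : ℝ :=
  kappa n / 2 + (n.factorial : ℝ) / (n : ℝ) ^ n * (((n : ℝ) + 1) / 2)

end LatinTest

namespace LatinTest

/-! Write p_k for the probability that the first k entries are distinct. The inner loop for i = k +
1 is reached exactly when they are. It then makes k comparisons, less m - 1 if s_{k+1} = s_m, and
each such match has conditional probability 1/n. Hence C_W = ∑ p_k (k - k(k-1)/(2n)). The recursion
p_{k+1} = p_k (1 - k/n) makes ∑ k p_k telescope and reduces ∑ k² p_k to ∑ p_k, which is `kappa` up
to explicit terms (`sum_expected_comparisons`).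

For the behaviour of `alpha`, put φ(t) = t - log(1 + t) and u = √(2φ). Expanding (1 + t)^n under the
integral gives ∑ p_k = ∫ n e^{-nφ} dt over t > 0. Also √(πn/2) is the integral of n e^{-nφ} φ'/u (a
Gaussian in u), and n e^{-nφ} φ' is a probability density. So `kappa n` is the mean of the weight
1/t - 1/u + 1/3 under that density (`kappa_eq_integral`). The weight increases strictly, is
arbitrarily small near 0 and lies in [0, 1/3] (`strictMonoOn_weight`, `exists_weight_lt`). The
densities shift towards 0 as n grows, so `kappa` decreases strictly to 0 (`kappa_succ_lt`,
`tendsto_kappa`). The factorial term does the same by elementary estimates. -/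

/-! ### The phase and its square-root coordinate -/

/-- The phase `t - log (1 + t)`. -/
noncomputable def phase (t : ℝ) : ℝ := t - Real.log (1 + t)

/-- The coordinate `u` with `u ^ 2 / 2 = phase t`. -/
noncomputable def phaseRoot (t : ℝ) : ℝ := √(2 * phase t)

/-- The weight `1 / t - 1 / u + 1 / 3`. -/
noncomputable def weight (t : ℝ) : ℝ := 1 / t - 1 / phaseRoot t + 1 / 3

lemma hasDerivAt_phase {t : ℝ} (ht : 0 ≤ t) : HasDerivAt phase (t / (1 + t)) t := by
  have h : (1 + t) ≠ 0 := by positivity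
  have := (hasDerivAt_id t).sub (((hasDerivAt_id t).const_add 1).log h)
  refine this.congr_deriv ?_
  simp only [id]
  field_simp
  ring

@[simp] lemma phase_zero : phase 0 = 0 := by simp [phase]

lemma phase_pos {t : ℝ} (ht : 0 < t) : 0 < phase t := by
  have := Real.log_lt_sub_one_of_pos (x := 1 + t) (by positivity) (by linarith)
  unfold phase
  linarith

lemma phase_nonneg {t : ℝ} (ht : 0 ≤ t) : 0 ≤ phase t := by
  rcases ht.eq_or_lt with rfl | h
  · simp
  · exact (phase_pos h).le

lemma continuousOn_phase : ContinuousOn phase (Set.Ici 0) :=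
  fun _ hx => (hasDerivAt_phase hx).continuousAt.continuousWithinAt

lemma strictMonoOn_phase : StrictMonoOn phase (Set.Ici 0) := by
  refine strictMonoOn_of_deriv_pos (convex_Ici 0) continuousOn_phase fun x hx => ?_
  rw [interior_Ici] at hx
  have hx : 0 < x := hx
  rw [(hasDerivAt_phase hx.le).deriv]
  positivity

lemma tendsto_phase_atTop : Tendsto phase atTop atTop := by
  have h : ∀ t : ℝ, 0 ≤ t → t / 2 - Real.log 2 ≤ phase t := by
    intro t ht
    have h1 := Real.log_le_sub_one_of_pos (x := (1 + t) / 2) (by positivity)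
    rw [Real.log_div (by positivity) (by norm_num)] at h1
    unfold phase
    linarith
  refine tendsto_atTop_mono' atTop ((eventually_ge_atTop 0).mono h) ?_
  exact tendsto_atTop_add_const_right _ _ (tendsto_id.atTop_div_const (by norm_num))

lemma phaseRoot_pos {t : ℝ} (ht : 0 < t) : 0 < phaseRoot t :=
  Real.sqrt_pos.2 (mul_pos two_pos (phase_pos ht))

lemma phaseRoot_sq {t : ℝ} (ht : 0 ≤ t) : phaseRoot t ^ 2 = 2 * phase t :=
  Real.sq_sqrt (mul_nonneg zero_le_two (phase_nonneg ht))

@[simp] lemma phaseRoot_zero : phaseRoot 0 = 0 := by simp [phaseRoot]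

lemma continuousOn_phaseRoot : ContinuousOn phaseRoot (Set.Ici 0) :=
  (continuousOn_phase.const_smul (2 : ℝ)).sqrt

lemma tendsto_phaseRoot_atTop : Tendsto phaseRoot atTop atTop :=
  Real.tendsto_sqrt_atTop.comp (tendsto_phase_atTop.const_mul_atTop two_pos)

lemma hasDerivAt_phaseRoot {t : ℝ} (ht : 0 < t) :
    HasDerivAt phaseRoot (t / (1 + t) / phaseRoot t) t := by
  have h := ((hasDerivAt_phase ht.le).const_mul 2).sqrt (mul_pos two_pos (phase_pos ht)).ne'
  refine h.congr_deriv ?_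
  have := phaseRoot_pos ht
  unfold phaseRoot at *
  field_simp

/-! ### Bounds and monotonicity of the weight -/

lemma hasDerivAt_sq_div_sub_log {c : ℝ} (hc : 0 < c) :
    HasDerivAt (fun c : ℝ => c ^ 4 - 2 * c + (c ^ 2)⁻¹ - 2 * c ^ 3 + 2 + 6 * Real.log c)
      (2 * (c ^ 3 - 1) * (c - 1) ^ 2 * (2 * c + 1) / c ^ 3) c := by
  have h := (((((hasDerivAt_pow 4 c).sub ((hasDerivAt_id c).const_mul 2)).add
    ((hasDerivAt_pow 2 c).inv (by positivity))).sub ((hasDerivAt_pow 3 c).const_mul 2)).add_const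
    2).add ((Real.hasDerivAt_log hc.ne').const_mul 6)
  refine h.congr_deriv ?_
  simp only [Nat.cast_ofNat]
  field_simp
  ring

/-- For c = (1 + t)^{1/3} the right side minus the left is rational plus 6 log c. It vanishes at c =
1, and its derivative factors into terms positive for c > 1. -/
lemma two_mul_phase_lt {c : ℝ} (hc : 1 < c) :
    2 * phase (c ^ 3 - 1) < ((c ^ 3 - 1) / c) ^ 2 := by
  have hm : StrictMonoOn
      (fun c : ℝ => c ^ 4 - 2 * c + (c ^ 2)⁻¹ - 2 * c ^ 3 + 2 + 6 * Real.log c) (Set.Ici 1) := by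
    refine strictMonoOn_of_deriv_pos (convex_Ici 1) (fun x hx => ?_) fun x hx => ?_
    · exact (hasDerivAt_sq_div_sub_log
        (one_pos.trans_le hx)).continuousAt.continuousWithinAt
    · rw [interior_Ici] at hx
      have hx : 1 < x := hx
      have h0 : 0 < x := by linarith
      rw [(hasDerivAt_sq_div_sub_log h0).deriv]
      have h1 : 0 < x ^ 3 - 1 := by nlinarith [one_lt_pow₀ hx (n := 3) (by norm_num)]
      have h2 : 0 < x - 1 := by linarith
      positivity
  have h := hm (Set.mem_Ici.2 le_rfl) (Set.mem_Ici.2 hc.le) hc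
  have h0 : 0 < c := by linarith
  have e : ((c ^ 3 - 1) / c) ^ 2 = c ^ 4 - 2 * c + (c ^ 2)⁻¹ := by
    field_simp
    ring
  rw [e]
  simp only [phase, add_sub_cancel, Real.log_pow]
  norm_num at h ⊢
  linarith

lemma exists_cube_root {t : ℝ} (ht : 0 < t) : ∃ c : ℝ, 1 < c ∧ t = c ^ 3 - 1 := by
  refine ⟨(1 + t) ^ (1 / 3 : ℝ), Real.one_lt_rpow (by linarith) (by norm_num), ?_⟩
  rw [← Real.rpow_natCast, ← Real.rpow_mul (by positivity)]
  norm_num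

lemma phaseRoot_lt {c : ℝ} (hc : 1 < c) : phaseRoot (c ^ 3 - 1) < (c ^ 3 - 1) / c := by
  have h1 : 0 < c ^ 3 - 1 := by linarith [one_lt_pow₀ hc (n := 3) (by norm_num)]
  refine lt_of_pow_lt_pow_left₀ 2 (by positivity) ?_
  rw [phaseRoot_sq h1.le]
  exact two_mul_phase_lt hc

/-- This is precisely the positivity of the derivative of `weight`. -/
lemma phaseRoot_pow_three_lt {t : ℝ} (ht : 0 < t) : (1 + t) * phaseRoot t ^ 3 < t ^ 3 := by
  have hu := phaseRoot_pos ht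
  obtain ⟨c, hc, rfl⟩ := exists_cube_root ht
  have h := pow_lt_pow_left₀ (phaseRoot_lt hc) hu.le (n := 3) (by norm_num)
  rw [div_pow, lt_div_iff₀ (by positivity)] at h
  linarith

lemma weight_le {c : ℝ} (hc : 1 < c) :
    weight (c ^ 3 - 1) ≤ 1 / 3 - 1 / (c ^ 2 + c + 1) := by
  have h1 : 0 < c ^ 3 - 1 := by linarith [one_lt_pow₀ hc (n := 3) (by norm_num)]
  have h2 : 0 < c - 1 := by linarith
  have h := one_div_lt_one_div_of_lt (phaseRoot_pos h1) (phaseRoot_lt hc)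
  have e : 1 / ((c ^ 3 - 1) / c) - 1 / (c ^ 3 - 1) = 1 / (c ^ 2 + c + 1) := by
    have : c ^ 3 - 1 = (c - 1) * (c ^ 2 + c + 1) := by ring
    have h3 : c ^ 2 + c + 1 ≠ 0 := by positivity
    rw [this]
    field_simp
  unfold weight
  linarith

lemma weight_le_third {t : ℝ} (ht : 0 < t) : weight t ≤ 1 / 3 := by
  obtain ⟨c, hc, rfl⟩ := exists_cube_root ht
  have : 0 < 1 / (c ^ 2 + c + 1) := by positivity
  linarith [weight_le hc]

lemma hasDerivAt_two_phase_sub {t : ℝ} (ht : 0 ≤ t) :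
    HasDerivAt (fun t => 2 * phase t - 9 * t ^ 2 / (3 + t) ^ 2)
      (2 * t ^ 3 * (9 + t) / ((1 + t) * (3 + t) ^ 3)) t := by
  have h := ((hasDerivAt_phase ht).const_mul 2).sub (((hasDerivAt_pow 2 t).const_mul 9).div
    (((hasDerivAt_id t).const_add 3).pow 2) (by simp only [id, Pi.pow_apply]; positivity))
  refine h.congr_deriv ?_
  simp only [id, Nat.cast_ofNat, Pi.pow_apply]
  field_simp
  ring

/-- Equivalent to u ≥ 3t/(3 + t). After squaring, the difference of the sides vanishes at 0 and has
positive derivative. -/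
lemma weight_nonneg {t : ℝ} (ht : 0 < t) : 0 ≤ weight t := by
  have hm : StrictMonoOn (fun t => 2 * phase t - 9 * t ^ 2 / (3 + t) ^ 2) (Set.Ici 0) := by
    refine strictMonoOn_of_deriv_pos (convex_Ici 0)
      (fun x hx => (hasDerivAt_two_phase_sub hx).continuousAt.continuousWithinAt) fun x hx => ?_
    rw [interior_Ici] at hx
    have hx : 0 < x := hx
    rw [(hasDerivAt_two_phase_sub hx.le).deriv]
    positivity
  have h := hm (Set.mem_Ici.2 le_rfl) (Set.mem_Ici.2 ht.le) ht
  simp only [phase_zero] at h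
  have h1 : (3 * t / (3 + t)) ≤ phaseRoot t := by
    refine Real.le_sqrt_of_sq_le ?_
    rw [div_pow, show (3 * t) ^ 2 = 9 * t ^ 2 by ring]
    norm_num at h
    linarith
  have h2 := one_div_le_one_div_of_le (by positivity) h1
  have e : 1 / (3 * t / (3 + t)) = 1 / t + 1 / 3 := by field_simp
  unfold weight
  linarith

lemma hasDerivAt_weight {t : ℝ} (ht : 0 < t) :
    HasDerivAt weight (t / (1 + t) / phaseRoot t / phaseRoot t ^ 2 - 1 / t ^ 2) t := by
  have hu := phaseRoot_pos ht
  have h := ((hasDerivAt_inv ht.ne').sub ((hasDerivAt_phaseRoot ht).inv hu.ne')).add_const (1 / 3)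
  have e : weight = fun t => t⁻¹ - (phaseRoot t)⁻¹ + 1 / 3 := by
    funext t
    simp [weight]
  rw [e]
  refine h.congr_deriv ?_
  field_simp
  ring

lemma strictMonoOn_weight : StrictMonoOn weight (Set.Ioi 0) := by
  refine strictMonoOn_of_deriv_pos (convex_Ioi 0)
    (fun x hx => (hasDerivAt_weight hx).continuousAt.continuousWithinAt) fun x hx => ?_
  rw [interior_Ioi] at hx
  have hx : 0 < x := hx
  rw [(hasDerivAt_weight hx).deriv, sub_pos]
  have hu := phaseRoot_pos hx
  have h := phaseRoot_pow_three_lt hx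
  have e : x / (1 + x) / phaseRoot x / phaseRoot x ^ 2 = x / ((1 + x) * phaseRoot x ^ 3) := by
    field_simp
  rw [e, div_lt_div_iff₀ (by positivity) (by positivity)]
  linarith [show x * x ^ 2 = x ^ 3 by ring]

lemma exists_weight_lt {ε : ℝ} (hε : 0 < ε) : ∃ d : ℝ, 0 < d ∧ weight d < ε := by
  have hc : ContinuousAt (fun c : ℝ => 1 / 3 - 1 / (c ^ 2 + c + 1)) 1 := by
    refine continuousAt_const.sub (continuousAt_const.div ?_ (by norm_num))
    fun_prop
  have h : ∀ᶠ c in 𝓝[>] (1 : ℝ), 1 / 3 - 1 / (c ^ 2 + c + 1) < ε := by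
    refine nhdsWithin_le_nhds (hc.eventually_lt continuousAt_const ?_)
    norm_num
    exact hε
  obtain ⟨c, h1, h2⟩ := (h.and self_mem_nhdsWithin).exists
  have h2 : 1 < c := h2
  exact ⟨c ^ 3 - 1, by linarith [one_lt_pow₀ h2 (n := 3) (by norm_num)],
    (weight_le h2).trans_lt h1⟩

/-! ### Distinctness probabilities and their moment sums -/

/-- The probability that `k` independent uniform elements of an `n`-element set are distinct. -/
noncomputable def distinctProb (n k : ℕ) : ℝ := (n.descFactorial k : ℝ) / (n : ℝ) ^ k

@[simp] lemma distinctProb_zero (n : ℕ) : distinctProb n 0 = 1 := by simp [distinctProb]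

lemma distinctProb_succ {n : ℕ} (hn : 1 ≤ n) (k : ℕ) :
    distinctProb n (k + 1) = distinctProb n k * (1 - k / n) := by
  have hn0 : (n : ℝ) ≠ 0 := by positivity
  unfold distinctProb
  rw [Nat.descFactorial_succ, Nat.cast_mul]
  -- The subtraction `n - k` truncates for k > n, but there both descending factorials vanish.
  rcases le_or_gt k n with h | h
  · rw [Nat.cast_sub h, pow_succ]
    field_simp
  · simp [Nat.descFactorial_eq_zero_iff_lt.2 h]

lemma distinctProb_self (n : ℕ) : distinctProb n n = (n.factorial : ℝ) / (n : ℝ) ^ n := by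
  simp [distinctProb, Nat.descFactorial_self]

lemma distinctProb_of_lt {n k : ℕ} (h : n < k) : distinctProb n k = 0 := by
  simp [distinctProb, Nat.descFactorial_eq_zero_iff_lt.2 h]

/-- The recursion says k p_k = n (p_k - p_{k+1}), so the sum telescopes. -/
lemma sum_mul_distinctProb {n : ℕ} (hn : 1 ≤ n) (m : ℕ) :
    ∑ k ∈ Finset.range m, (k : ℝ) * distinctProb n k = n * (1 - distinctProb n m) := by
  have hn0 : (n : ℝ) ≠ 0 := by positivity
  induction m with
  | zero => simp
  | succ m ih =>
    rw [Finset.sum_range_succ, ih, distinctProb_succ hn]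
    field_simp
    ring

/-- Summation by parts of k² p_k = n k (p_k - p_{k+1}). -/
lemma sum_sq_mul_distinctProb {n : ℕ} (hn : 1 ≤ n) (m : ℕ) :
    ∑ k ∈ Finset.range m, (k : ℝ) ^ 2 * distinctProb n k =
      n * (∑ k ∈ Finset.range m, distinctProb n k - 1 - (m - 1) * distinctProb n m) := by
  have hn0 : (n : ℝ) ≠ 0 := by positivity
  induction m with
  | zero => simp
  | succ m ih =>
    rw [Finset.sum_range_succ, Finset.sum_range_succ, ih, distinctProb_succ hn]
    push_cast
    field_simp
    ring

lemma kappa_sum_eq {n : ℕ} (hn : 1 ≤ n) :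
    ∑ k ∈ Finset.Icc 1 n,
        ((n.factorial : ℝ) * (k : ℝ) ^ 2) / (((n - k).factorial : ℝ) * (n : ℝ) ^ (k + 1)) =
      (∑ k ∈ Finset.range (n + 1), (k : ℝ) ^ 2 * distinctProb n k) / n := by
  have hn0 : (n : ℝ) ≠ 0 := by positivity
  rw [Finset.range_eq_Ico, Finset.sum_eq_sum_Ico_succ_bot (Nat.succ_pos n),
    ← Finset.Ico_add_one_right_eq_Icc]
  simp only [Nat.cast_zero, ne_eq, OfNat.ofNat_ne_zero, not_false_eq_true, zero_pow, zero_mul,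
    zero_add, Finset.sum_div]
  refine Finset.sum_congr rfl fun k hk => ?_
  have hk : k ≤ n := by
    rw [Finset.mem_Ico] at hk
    omega
  have hf : ((n - k).factorial : ℝ) ≠ 0 := by positivity
  have h : (n.factorial : ℝ) = (n - k).factorial * n.descFactorial k := by
    exact_mod_cast (Nat.factorial_mul_descFactorial hk).symm
  rw [h, distinctProb, pow_succ (n : ℝ) k]
  field_simp

lemma kappa_eq_sum_distinctProb {n : ℕ} (hn : 1 ≤ n) :
    kappa n = ∑ k ∈ Finset.range (n + 1), distinctProb n k - √(Real.pi * n / 2) - 2 / 3 := by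
  have hn0 : (n : ℝ) ≠ 0 := by positivity
  rw [kappa, kappa_sum_eq hn, sum_sq_mul_distinctProb hn, distinctProb_of_lt (Nat.lt_succ_self n)]
  field_simp
  ring

/-! ### Integral representation of kappa -/

lemma integrableOn_pow_mul_exp {n : ℕ} (hn : 1 ≤ n) (k : ℕ) :
    IntegrableOn (fun t : ℝ => t ^ k * Real.exp (-(n * t))) (Set.Ioi 0) := by
  have h := integrableOn_rpow_mul_exp_neg_mul_rpow (s := k) (p := 1) (b := n)
    (by linarith [k.cast_nonneg (α := ℝ)]) one_pos (by positivity)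
  simpa using h

lemma integral_pow_mul_exp {n : ℕ} (hn : 1 ≤ n) (k : ℕ) :
    ∫ t in Set.Ioi (0 : ℝ), t ^ k * Real.exp (-(n * t)) = k.factorial / (n : ℝ) ^ (k + 1) := by
  have h := Real.integral_rpow_mul_exp_neg_mul_Ioi (a := k + 1) (r := n) (by positivity)
    (by positivity)
  rw [Real.Gamma_nat_eq_factorial] at h
  simp only [add_sub_cancel_right, Real.rpow_natCast] at h
  rw [h, ← Nat.cast_add_one, Real.rpow_natCast]
  simp
  ring

lemma exp_neg_mul_phase (n : ℕ) {t : ℝ} (ht : 0 < t) :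
    Real.exp (-(n * phase t)) =
      ∑ k ∈ Finset.range (n + 1), (n.choose k : ℝ) * (t ^ k * Real.exp (-(n * t))) := by
  have h : -(n * phase t) = n * Real.log (1 + t) + -(n * t) := by
    unfold phase
    ring
  rw [h, Real.exp_add, Real.exp_nat_mul, Real.exp_log (by positivity), add_comm, add_pow,
    Finset.sum_mul]
  refine Finset.sum_congr rfl fun k _ => ?_
  ring

lemma integrableOn_exp_phase {n : ℕ} (hn : 1 ≤ n) :
    IntegrableOn (fun t => Real.exp (-(n * phase t))) (Set.Ioi 0) := by
  have h : IntegrableOn (fun t : ℝ => ∑ k ∈ Finset.range (n + 1),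
      (n.choose k : ℝ) * (t ^ k * Real.exp (-(n * t)))) (Set.Ioi 0) :=
    integrable_finsetSum _ fun k _ => (integrableOn_pow_mul_exp hn k).const_mul _
  exact h.congr_fun (fun t ht => (exp_neg_mul_phase n ht).symm) measurableSet_Ioi

lemma integral_exp_phase {n : ℕ} (hn : 1 ≤ n) :
    ∫ t in Set.Ioi 0, n * Real.exp (-(n * phase t)) =
      ∑ k ∈ Finset.range (n + 1), distinctProb n k := by
  have hn0 : (n : ℝ) ≠ 0 := by positivity
  rw [integral_const_mul, setIntegral_congr_fun measurableSet_Ioi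
    (fun t ht => exp_neg_mul_phase n ht),
    integral_finsetSum _ fun k _ => (integrableOn_pow_mul_exp hn k).const_mul _, Finset.mul_sum]
  refine Finset.sum_congr rfl fun k _ => ?_
  rw [integral_const_mul, integral_pow_mul_exp hn, distinctProb,
    Nat.descFactorial_eq_factorial_mul_choose, pow_succ]
  push_cast
  field_simp

lemma hasDerivAt_exp_phase (n : ℕ) {t : ℝ} (ht : 0 ≤ t) :
    HasDerivAt (fun t => -Real.exp (-(n * phase t)))
      (n * Real.exp (-(n * phase t)) * (t / (1 + t))) t := by
  have h := ((hasDerivAt_phase ht).const_mul (n : ℝ)).neg.exp.neg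
  refine h.congr_deriv ?_
  simp only [Pi.neg_apply]
  ring

lemma continuousOn_exp_phase (n : ℕ) :
    ContinuousOn (fun t => n * Real.exp (-(n * phase t))) (Set.Ici 0) :=
  continuousOn_const.mul (continuousOn_const.mul continuousOn_phase).neg.rexp

lemma integrableOn_exp_phase_mul {n : ℕ} (hn : 1 ≤ n) {f : ℝ → ℝ}
    (hf : ContinuousOn f (Set.Ioi 0)) (hb : ∀ t, 0 < t → |f t| ≤ 1) :
    IntegrableOn (fun t => n * Real.exp (-(n * phase t)) * f t) (Set.Ioi 0) := by
  refine Integrable.mono' ((integrableOn_exp_phase hn).const_mul (n : ℝ)) ?_ ?_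
  · exact (((continuousOn_exp_phase n).mono Set.Ioi_subset_Ici_self).mul
      hf).aestronglyMeasurable measurableSet_Ioi
  · refine (ae_restrict_iff' measurableSet_Ioi).2 (Eventually.of_forall fun t ht => ?_)
    rw [norm_mul, Real.norm_of_nonneg (by positivity)]
    exact mul_le_of_le_one_right (by positivity) (hb t ht)

lemma continuousOn_phase_deriv : ContinuousOn (fun t : ℝ => t / (1 + t)) (Set.Ioi 0) := by
  refine continuousOn_id.div (by fun_prop) fun t ht => ?_
  have ht : 0 < t := ht
  positivity

lemma abs_phase_deriv_le {t : ℝ} (ht : 0 < t) : |t / (1 + t)| ≤ 1 := by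
  rw [abs_of_pos (by positivity), div_le_one (by positivity)]
  linarith

lemma integrableOn_exp_phase_deriv {n : ℕ} (hn : 1 ≤ n) :
    IntegrableOn (fun t => n * Real.exp (-(n * phase t)) * (t / (1 + t))) (Set.Ioi 0) :=
  integrableOn_exp_phase_mul hn continuousOn_phase_deriv fun _ => abs_phase_deriv_le

lemma integral_Ioi_exp_phase_deriv {n : ℕ} (hn : 1 ≤ n) {d : ℝ} (hd : 0 ≤ d) :
    ∫ t in Set.Ioi d, n * Real.exp (-(n * phase t)) * (t / (1 + t)) =
      Real.exp (-(n * phase d)) := by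
  have h := integral_Ioi_of_hasDerivAt_of_tendsto' (a := d) (m := 0)
    (f := fun t => -Real.exp (-(n * phase t)))
    (fun t ht => hasDerivAt_exp_phase n (hd.trans ht))
    ((integrableOn_exp_phase_deriv hn).mono_set (Set.Ioi_subset_Ioi hd)) (by
      rw [← neg_zero]
      refine (Real.tendsto_exp_atBot.comp (tendsto_neg_atTop_atBot.comp ?_)).neg
      exact tendsto_phase_atTop.const_mul_atTop (by positivity))
  rw [h]
  simp

lemma integral_exp_phase_deriv {n : ℕ} (hn : 1 ≤ n) :
    ∫ t in Set.Ioi 0, n * Real.exp (-(n * phase t)) * (t / (1 + t)) = 1 := by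
  rw [integral_Ioi_exp_phase_deriv hn le_rfl]
  simp

lemma continuousOn_weight : ContinuousOn weight (Set.Ioi 0) :=
  fun _ hx => (hasDerivAt_weight hx).continuousAt.continuousWithinAt

lemma phase_deriv_mul_weight {t : ℝ} (ht : 0 < t) :
    t / (1 + t) * weight t = 1 - t / (1 + t) / phaseRoot t - 2 / 3 * (t / (1 + t)) := by
  have := phaseRoot_pos ht
  unfold weight
  field_simp
  ring

lemma continuousOn_phaseRoot_deriv :
    ContinuousOn (fun t => t / (1 + t) / phaseRoot t) (Set.Ioi 0) :=
  continuousOn_phase_deriv.div (continuousOn_phaseRoot.mono Set.Ioi_subset_Ici_self)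
    fun _ ht => (phaseRoot_pos ht).ne'

/-- Nonnegativity of φ' · `weight` = 1 - φ'/u - (2/3) φ' already forces φ'/u ≤ 1. -/
lemma abs_phaseRoot_deriv_le {t : ℝ} (ht : 0 < t) : |t / (1 + t) / phaseRoot t| ≤ 1 := by
  have h1 : 0 < t / (1 + t) := by positivity
  have h2 := mul_nonneg h1.le (weight_nonneg ht)
  rw [phase_deriv_mul_weight ht] at h2
  rw [abs_of_pos (div_pos h1 (phaseRoot_pos ht))]
  linarith

lemma integral_exp_phaseRoot_deriv {n : ℕ} (hn : 1 ≤ n) :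
    ∫ t in Set.Ioi 0, n * Real.exp (-(n * phase t)) * (t / (1 + t) / phaseRoot t) =
      √(Real.pi * n / 2) := by
  have hn0 : (0 : ℝ) < n := by positivity
  have e : ∀ t : ℝ, 0 ≤ t → n * Real.exp (-(n * phase t)) * (t / (1 + t) / phaseRoot t) =
      ((fun u : ℝ => n * Real.exp (-(n / 2) * u ^ 2)) ∘ phaseRoot) t *
        (t / (1 + t) / phaseRoot t) := by
    intro t ht
    simp only [Function.comp, phaseRoot_sq ht]
    ring_nf
  have hint : IntegrableOn (fun u : ℝ => n * Real.exp (-(n / 2) * u ^ 2)) Set.univ :=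
    ((integrable_exp_neg_mul_sq (b := n / 2) (by positivity)).const_mul (n : ℝ)).integrableOn
  -- Substituting u = `phaseRoot t` turns the integral into a half-line Gaussian.
  rw [setIntegral_congr_fun measurableSet_Ioi fun t ht => e t (Set.mem_Ioi.1 ht).le,
    integral_comp_mul_deriv_Ioi continuousOn_phaseRoot tendsto_phaseRoot_atTop
      (fun t ht => (hasDerivAt_phaseRoot ht).hasDerivWithinAt) (by fun_prop)
      (hint.mono_set (Set.subset_univ _)) ?_, phaseRoot_zero, integral_const_mul,
    integral_gaussian_Ioi]
  · rw [show Real.pi * n / 2 = (n / 2) ^ 2 * (Real.pi / (n / 2)) by field_simp,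
      Real.sqrt_mul (by positivity), Real.sqrt_sq (by positivity)]
    ring
  · rw [integrableOn_Ici_iff_integrableOn_Ioi]
    exact (integrableOn_exp_phase_mul hn continuousOn_phaseRoot_deriv
      fun _ => abs_phaseRoot_deriv_le).congr_fun
        (fun t ht => e t (Set.mem_Ioi.1 ht).le) measurableSet_Ioi

lemma abs_phase_deriv_mul_weight_le {t : ℝ} (ht : 0 < t) : |t / (1 + t) * weight t| ≤ 1 := by
  rw [abs_mul]
  refine mul_le_one₀ (abs_phase_deriv_le ht) (abs_nonneg _) ?_
  rw [abs_of_nonneg (weight_nonneg ht)]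
  linarith [weight_le_third ht]

lemma integrableOn_exp_phase_deriv_mul_weight {n : ℕ} (hn : 1 ≤ n) :
    IntegrableOn (fun t => n * Real.exp (-(n * phase t)) * (t / (1 + t) * weight t))
      (Set.Ioi 0) :=
  integrableOn_exp_phase_mul hn (continuousOn_phase_deriv.mul continuousOn_weight)
    fun _ => abs_phase_deriv_mul_weight_le

lemma kappa_eq_integral {n : ℕ} (hn : 1 ≤ n) :
    kappa n =
      ∫ t in Set.Ioi 0, n * Real.exp (-(n * phase t)) * (t / (1 + t) * weight t) := by
  have e : ∀ t ∈ Set.Ioi (0 : ℝ),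
      n * Real.exp (-(n * phase t)) * (t / (1 + t) * weight t) =
        n * Real.exp (-(n * phase t))
          - n * Real.exp (-(n * phase t)) * (t / (1 + t) / phaseRoot t)
          - 2 / 3 * (n * Real.exp (-(n * phase t)) * (t / (1 + t))) := by
    intro t ht
    rw [phase_deriv_mul_weight ht]
    ring
  have h1 := (integrableOn_exp_phase hn).const_mul (n : ℝ)
  have h2 := integrableOn_exp_phase_mul hn continuousOn_phaseRoot_deriv
      fun _ => abs_phaseRoot_deriv_le
  have h3 := (integrableOn_exp_phase_deriv hn).const_mul (2 / 3)
  have h12 : IntegrableOn (fun t => n * Real.exp (-(n * phase t)) -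
      n * Real.exp (-(n * phase t)) * (t / (1 + t) / phaseRoot t)) (Set.Ioi 0) := h1.sub h2
  rw [setIntegral_congr_fun measurableSet_Ioi e, integral_sub h12 h3, integral_sub h1 h2, integral_const_mul (2 / 3 : ℝ), integral_exp_phase hn,
    integral_exp_phaseRoot_deriv hn, integral_exp_phase_deriv hn, kappa_eq_sum_distinctProb hn]
  ring

/-! ### Strict decrease and limit of kappa -/

/-- A single-crossing argument. The difference of consecutive densities and `weight t - weight t₀`
both pass from negative to positive at the same `t₀`. Subtracting the constant `weight t₀` costs
nothing, since both densities have mass 1. -/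
lemma kappa_succ_lt {n : ℕ} (hn : 1 ≤ n) : kappa (n + 1) < kappa n := by
  have hn' : 1 ≤ n + 1 := by omega
  have hn0 : (0 : ℝ) < n := by positivity
  -- The densities agree where n e^{-nφ} = (n + 1) e^{-(n+1)φ}, that is, e^φ = (n + 1)/n.
  obtain ⟨t₀, ht₀, hphase⟩ : ∃ t₀, 0 < t₀ ∧ phase t₀ = Real.log ((n + 1) / n) := by
    have hL : 0 < Real.log ((n + 1) / n) :=
      Real.log_pos ((one_lt_div hn0).2 (by linarith))
    obtain ⟨b, hb1, hb2⟩ := ((tendsto_phase_atTop.eventually_ge_atTop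
      (Real.log ((n + 1) / n))).and (eventually_ge_atTop 0)).exists
    obtain ⟨t, ht, h⟩ := intermediate_value_Icc hb2
      (continuousOn_phase.mono Set.Icc_subset_Ici_self)
      (show Real.log ((n + 1) / n) ∈ Set.Icc (phase 0) (phase b) from
        ⟨by rw [phase_zero]; exact hL.le, hb1⟩)
    refine ⟨t, lt_of_le_of_ne ht.1 ?_, h⟩
    rintro rfl
    rw [phase_zero] at h
    exact hL.ne h
  set w : ℝ → ℝ := fun t => n * Real.exp (-(n * phase t)) * (t / (1 + t)) -
    (n + 1 : ℕ) * Real.exp (-((n + 1 : ℕ) * phase t)) * (t / (1 + t)) with hw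
  have hw_eq : ∀ t, w t = Real.exp (-((n + 1) * phase t)) * (t / (1 + t)) * n *
      (Real.exp (phase t) - Real.exp (phase t₀)) := by
    intro t
    have h1 : Real.exp (-(n * phase t)) =
        Real.exp (-((n + 1) * phase t)) * Real.exp (phase t) := by
      rw [← Real.exp_add]
      ring_nf
    rw [hphase, Real.exp_log (by positivity), hw]
    simp only [h1]
    push_cast
    field_simp
  have hpos : ∀ t, 0 < t → t ≠ t₀ → 0 < w t * (weight t - weight t₀) := by
    intro t ht hne
    rw [hw_eq]
    have hc : 0 < Real.exp (-((n + 1) * phase t)) * (t / (1 + t)) * n := by positivity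
    rw [mul_assoc]
    refine mul_pos hc ?_
    rcases lt_or_gt_of_ne hne with h | h
    · refine mul_pos_of_neg_of_neg (sub_neg.2 (Real.exp_lt_exp.2 ?_)) (sub_neg.2 ?_)
      · exact strictMonoOn_phase ht.le ht₀.le h
      · exact strictMonoOn_weight ht ht₀ h
    · refine mul_pos (sub_pos.2 (Real.exp_lt_exp.2 ?_)) (sub_pos.2 ?_)
      · exact strictMonoOn_phase ht₀.le ht.le h
      · exact strictMonoOn_weight ht₀ ht h
  have i1 := integrableOn_exp_phase_deriv_mul_weight hn
  have i2 := integrableOn_exp_phase_deriv_mul_weight hn'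
  have j1 := integrableOn_exp_phase_deriv hn
  have j2 := integrableOn_exp_phase_deriv hn'
  have e : (fun t => w t * (weight t - weight t₀)) = fun t =>
      (n * Real.exp (-(n * phase t)) * (t / (1 + t) * weight t) -
        (n + 1 : ℕ) * Real.exp (-((n + 1 : ℕ) * phase t)) * (t / (1 + t) * weight t)) -
      weight t₀ * (n * Real.exp (-(n * phase t)) * (t / (1 + t)) -
        (n + 1 : ℕ) * Real.exp (-((n + 1 : ℕ) * phase t)) * (t / (1 + t))) := by
    funext t
    simp only [hw]
    ring
  have hint : IntegrableOn (fun t => w t * (weight t - weight t₀)) (Set.Ioi 0) := by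
    rw [e]
    exact (i1.sub i2).sub ((j1.sub j2).const_mul _)
  have hval : ∫ t in Set.Ioi 0, w t * (weight t - weight t₀) = kappa n - kappa (n + 1) := by
    have e1 := integral_sub (i1.sub i2) ((j1.sub j2).const_mul (weight t₀))
    simp only [Pi.sub_apply] at e1
    rw [e, e1, integral_sub i1 i2, integral_const_mul, integral_sub j1 j2, integral_exp_phase_deriv hn,
      integral_exp_phase_deriv hn', kappa_eq_integral hn, kappa_eq_integral hn']
    ring
  rw [← sub_pos, ← hval]
  rw [setIntegral_pos_iff_support_of_nonneg_ae ?_ hint]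
  · have hsub : Set.Ioo 0 t₀ ⊆
        (Function.support fun t => w t * (weight t - weight t₀)) ∩ Set.Ioi 0 :=
      fun t ht => ⟨(hpos t ht.1 ht.2.ne).ne', ht.1⟩
    refine lt_of_lt_of_le ?_ (measure_mono hsub)
    simpa using ht₀
  · refine (ae_restrict_iff' measurableSet_Ioi).2 (Eventually.of_forall fun t ht => ?_)
    rcases eq_or_ne t t₀ with rfl | h
    · simp
    · exact (hpos t ht h).le

lemma kappa_nonneg {n : ℕ} (hn : 1 ≤ n) : 0 ≤ kappa n := by
  rw [kappa_eq_integral hn]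
  refine setIntegral_nonneg measurableSet_Ioi fun t ht => ?_
  have ht : 0 < t := ht
  have := weight_nonneg ht
  positivity

/-- Up to d the weight is at most `weight d`. Beyond d the excess is at most 1/3, on a set of mass
e^{-nφ(d)}. -/
lemma kappa_le {n : ℕ} (hn : 1 ≤ n) {d : ℝ} (hd : 0 < d) :
    kappa n ≤ weight d + 1 / 3 * Real.exp (-(n * phase d)) := by
  have i := integrableOn_exp_phase_deriv_mul_weight hn
  have j := integrableOn_exp_phase_deriv hn
  set f : ℝ → ℝ := fun t => n * Real.exp (-(n * phase t)) * (t / (1 + t) * weight t) -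
    weight d * (n * Real.exp (-(n * phase t)) * (t / (1 + t))) with hf
  have hint : IntegrableOn f (Set.Ioi 0) := i.sub (j.const_mul _)
  have hval : ∫ t in Set.Ioi 0, f t = kappa n - weight d := by
    rw [hf, integral_sub i (j.const_mul _), integral_const_mul, integral_exp_phase_deriv hn,
      kappa_eq_integral hn, mul_one]
  have hf' : ∀ t, f t = n * Real.exp (-(n * phase t)) * (t / (1 + t)) *
      (weight t - weight d) := fun t => by simp only [hf]; ring
  have h1 : ∫ t in Set.Ioc 0 d, f t ≤ 0 := by
    refine setIntegral_nonpos measurableSet_Ioc fun t ht => ?_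
    have ht0 : 0 < t := ht.1
    rw [hf']
    exact mul_nonpos_of_nonneg_of_nonpos (by positivity)
      (sub_nonpos.2 (strictMonoOn_weight.monotoneOn ht0 hd ht.2))
  have h2 : ∫ t in Set.Ioi d, f t ≤ 1 / 3 * Real.exp (-(n * phase d)) := by
    rw [← integral_Ioi_exp_phase_deriv hn hd.le, ← integral_const_mul]
    refine setIntegral_mono_on (hint.mono_set (Set.Ioi_subset_Ioi hd.le))
      ((j.mono_set (Set.Ioi_subset_Ioi hd.le)).const_mul _) measurableSet_Ioi fun t ht => ?_
    have ht0 : 0 < t := hd.trans ht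
    rw [hf', mul_comm]
    refine mul_le_mul_of_nonneg_right ?_ (by positivity)
    linarith [weight_le_third ht0, weight_nonneg hd]
  have h3 : ∫ t in Set.Ioi 0, f t = (∫ t in Set.Ioc 0 d, f t) + ∫ t in Set.Ioi d, f t := by
    rw [← Set.Ioc_union_Ioi_eq_Ioi hd.le]
    exact setIntegral_union (Set.Ioc_disjoint_Ioi le_rfl) measurableSet_Ioi
      (hint.mono_set Set.Ioc_subset_Ioi_self) (hint.mono_set (Set.Ioi_subset_Ioi hd.le))
  linarith

lemma tendsto_kappa : Tendsto kappa atTop (𝓝 0) := by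
  rw [tendsto_order]
  refine ⟨fun a ha => ?_, fun a ha => ?_⟩
  · filter_upwards [eventually_ge_atTop 1] with n hn using ha.trans_le (kappa_nonneg hn)
  · obtain ⟨d, hd, hw⟩ := exists_weight_lt ha
    have h : Tendsto (fun n : ℕ => weight d + 1 / 3 * Real.exp (-(n * phase d))) atTop
        (𝓝 (weight d + 1 / 3 * 0)) := by
      refine ((Real.tendsto_exp_atBot.comp
        (tendsto_neg_atTop_atBot.comp ?_)).const_mul _).const_add _
      exact tendsto_natCast_atTop_atTop.atTop_mul_const (phase_pos hd)
    rw [mul_zero, add_zero] at h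
    filter_upwards [eventually_ge_atTop 1, h.eventually_lt_const hw] with n hn hlt
      using (kappa_le hn hd).trans_lt hlt

/-! ### The factorial term and alpha -/

lemma factorial_div_pow_mul_succ_lt {n : ℕ} (hn : 1 ≤ n) :
    ((n + 1).factorial : ℝ) / ((n + 1 : ℕ) : ℝ) ^ (n + 1) * ((((n + 1 : ℕ) : ℝ) + 1) / 2) <
      (n.factorial : ℝ) / (n : ℝ) ^ n * (((n : ℝ) + 1) / 2) := by
  have hn1 : (1 : ℝ) ≤ n := by exact_mod_cast hn
  have hn0 : (0 : ℝ) < n := by positivity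
  -- Bernoulli's inequality for (1 + 1/n)^n; it suffices because n + 2 < 2(n + 1).
  have hb : 2 * (n : ℝ) ^ n ≤ (n + 1) ^ n := by
    have h := one_add_mul_le_pow (a := 1 / (n : ℝ)) (by linarith [one_div_pos.2 hn0]) n
    rw [mul_one_div_cancel hn0.ne', show 1 + 1 / (n : ℝ) = (n + 1) / n by field_simp,
      div_pow, le_div_iff₀ (by positivity)] at h
    linarith
  have hf : (0 : ℝ) < n.factorial := by positivity
  have hp : (0 : ℝ) < (n : ℝ) ^ n := by positivity
  have hq : (0 : ℝ) < ((n : ℝ) + 1) ^ n := by positivity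
  rw [Nat.factorial_succ]
  push_cast
  rw [pow_succ, div_mul_div_comm, div_mul_div_comm, div_lt_div_iff₀ (by positivity)
    (by positivity)]
  have key : ((n : ℝ) + 1 + 1) * (n : ℝ) ^ n < (n + 1) * (n + 1) ^ n := by nlinarith
  have := mul_lt_mul_of_pos_left key (by positivity : (0 : ℝ) < (n + 1) * n.factorial * 2)
  linarith

lemma alpha_succ_lt {n : ℕ} (hn : 1 ≤ n) : alpha (n + 1) < alpha n := by
  have h1 := kappa_succ_lt hn
  have h2 := factorial_div_pow_mul_succ_lt hn
  unfold alpha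
  linarith

lemma strictAntiOn_alpha : StrictAntiOn alpha (Set.Ici 1) := by
  intro a ha b _ hab
  induction b, Nat.succ_le_of_lt hab using Nat.le_induction with
  | base => exact alpha_succ_lt ha
  | succ m hm ih =>
    have ha : 1 ≤ a := ha
    exact (alpha_succ_lt (by omega)).trans
      (ih (Set.mem_Ici.2 (by omega)) (by omega))

lemma tendsto_factorial_div_pow_mul :
    Tendsto (fun n : ℕ => (n.factorial : ℝ) / (n : ℝ) ^ n * (((n : ℝ) + 1) / 2)) atTop (𝓝 0) := by
  have hle : ∀ n : ℕ, 2 ≤ n → (n.factorial : ℝ) / (n : ℝ) ^ n ≤ 2 / (n : ℝ) ^ 2 := by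
    intro n hn
    obtain ⟨m, rfl⟩ := Nat.exists_eq_add_of_le hn
    have h1 : (2 + m).factorial ≤ 2 * (2 + m) ^ m := by
      rw [← Nat.factorial_mul_ascFactorial 2 m]
      exact Nat.mul_le_mul_left _ (Nat.ascFactorial_le_pow_add 2 m)
    have h2 : ((2 + m).factorial : ℝ) ≤ 2 * ((2 + m : ℕ) : ℝ) ^ m := by exact_mod_cast h1
    rw [pow_add, div_le_div_iff₀ (by positivity) (by positivity)]
    nlinarith [sq_nonneg ((2 + m : ℕ) : ℝ)]
  refine squeeze_zero' (g := fun n : ℕ => 2 / (n : ℝ)) (Eventually.of_forall fun n => by positivity)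
    ?_ (tendsto_const_div_atTop_nhds_zero_nat 2)
  filter_upwards [eventually_ge_atTop 2] with n hn
  have hn2 : (2 : ℝ) ≤ n := by exact_mod_cast hn
  calc (n.factorial : ℝ) / (n : ℝ) ^ n * (((n : ℝ) + 1) / 2)
      ≤ 2 / (n : ℝ) ^ 2 * (((n : ℝ) + 1) / 2) :=
        mul_le_mul_of_nonneg_right (hle n hn) (by positivity)
    _ ≤ 2 / n := by
        rw [div_mul_div_comm, div_le_div_iff₀ (by positivity) (by positivity)]
        nlinarith

lemma tendsto_alpha : Tendsto alpha atTop (𝓝 0) := by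
  have h := (tendsto_kappa.div_const 2).add tendsto_factorial_div_pow_mul
  rw [zero_div, zero_add] at h
  exact h

/-! ### Closed form of the expected count -/

lemma sum_expected_comparisons {n : ℕ} (hn : 1 ≤ n) :
    ∑ k ∈ Finset.range n, distinctProb n k * (k - k * (k - 1) / (2 * n)) =
      (n : ℝ) - √(Real.pi * n / 8) + 2 / 3 - alpha n := by
  have hn0 : (n : ℝ) ≠ 0 := by positivity
  have h : ∑ k ∈ Finset.range n, distinctProb n k * (k - k * (k - 1) / (2 * n)) =
      (1 + 1 / (2 * n)) * ∑ k ∈ Finset.range n, (k : ℝ) * distinctProb n k -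
        1 / (2 * n) * ∑ k ∈ Finset.range n, (k : ℝ) ^ 2 * distinctProb n k := by
    rw [Finset.mul_sum, Finset.mul_sum, ← Finset.sum_sub_distrib]
    refine Finset.sum_congr rfl fun k _ => ?_
    field_simp
    ring
  have hs : √(Real.pi * n / 8) = √(Real.pi * n / 2) / 2 := by
    rw [show Real.pi * n / 8 = Real.pi * n / 2 / 2 ^ 2 by ring, Real.sqrt_div (by positivity),
      Real.sqrt_sq (by norm_num)]
  rw [h, sum_mul_distinctProb hn, sum_sq_mul_distinctProb hn, hs, alpha,
    kappa_eq_sum_distinctProb hn, Finset.sum_range_succ, ← distinctProb_self]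
  field_simp
  ring

/-! ### Counting comparisons for a fixed input -/

lemma backwardInner_fst (s : ℕ → ℕ) (i j : ℕ) :
    (backwardInner s i j).1 = true ↔ ∃ m ∈ Finset.Icc 1 j, s i = s m := by
  induction j with
  | zero => simp [backwardInner]
  | succ j ih =>
    have hI : Finset.Icc 1 (j + 1) = insert (j + 1) (Finset.Icc 1 j) :=
      (Finset.insert_Icc_right_eq_Icc_add_one (by omega)).symm
    rw [hI, Finset.exists_mem_insert, ← ih, backwardInner]
    split_ifs with h <;> simp [h]

/-- Injectivity allows at most one match m; stopping there saves the m - 1 comparisons with smaller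
indices. -/
lemma backwardInner_snd {s : ℕ → ℕ} (i : ℕ) {j : ℕ} (hs : Set.InjOn s (Set.Icc 1 j)) :
    ((backwardInner s i j).2 : ℝ) =
      j - ∑ m ∈ Finset.Icc 1 j, if s i = s m then (m - 1 : ℝ) else 0 := by
  induction j with
  | zero => simp [backwardInner]
  | succ j ih =>
    rw [← Finset.insert_Icc_right_eq_Icc_add_one (by omega), Finset.sum_insert (by simp),
      backwardInner]
    split_ifs with h
    · rw [Finset.sum_eq_zero]
      · push_cast
        ring
      · intro m hm
        rw [Finset.mem_Icc] at hm
        refine if_neg fun h' => ?_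
        have := hs ⟨hm.1, by omega⟩ ⟨by omega, le_rfl⟩ (h'.symm.trans h)
        omega
    · have := ih (hs.mono (Set.Icc_subset_Icc_right (Nat.le_succ j)))
      push_cast
      rw [this]
      ring

lemma injOn_Icc_succ_iff (s : ℕ → ℕ) (l : ℕ) :
    Set.InjOn s (Set.Icc 1 (l + 1)) ↔
      Set.InjOn s (Set.Icc 1 l) ∧ ¬ ∃ m ∈ Finset.Icc 1 l, s (l + 1) = s m := by
  have hI : Set.Icc 1 (l + 1) = insert (l + 1) (Set.Icc 1 l) := by
    ext m
    simp only [Set.mem_Icc, Set.mem_insert_iff]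
    omega
  rw [hI, Set.injOn_insert (by simp)]
  simp [eq_comm]

-- The summation index is k = i - 1. Once a repetition occurs, injectivity fails for every longer
-- prefix, so the later terms vanish just as the algorithm stops.
open Classical in
lemma backwardOuter_snd {s : ℕ → ℕ} (m l : ℕ) (hs : Set.InjOn s (Set.Icc 1 l)) :
    (backwardOuter s m (l + 1)).2 = ∑ k ∈ Finset.Ico l (l + m),
      if Set.InjOn s (Set.Icc 1 k) then (backwardInner s (k + 1) k).2 else 0 := by
  induction m generalizing l with
  | zero => simp [backwardOuter]
  | succ m ih =>
    rw [backwardOuter, Finset.sum_eq_sum_Ico_succ_bot (by omega), if_pos hs,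
      Nat.add_sub_cancel]
    have hiff := injOn_Icc_succ_iff s l
    rw [← backwardInner_fst] at hiff
    split_ifs with h
    · rw [Finset.sum_eq_zero]
      · rfl
      · intro k hk
        rw [Finset.mem_Ico] at hk
        exact if_neg fun h' => (hiff.1 (h'.mono (Set.Icc_subset_Icc_right hk.1))).2 h
    · rw [ih (l + 1) (hiff.2 ⟨hs, h⟩), show l + 1 + m = l + (m + 1) by ring]

open Classical in
lemma backwardComparisons_eq {n : ℕ} (hn : 1 ≤ n) (s : ℕ → ℕ) :
    (backwardComparisons n s : ℝ) = ∑ k ∈ Finset.Ico 1 n,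
      ((if Set.InjOn s (Set.Icc 1 k) then (k : ℝ) else 0) - ∑ m ∈ Finset.Icc 1 k,
        (m - 1) * if Set.InjOn s (Set.Icc 1 k) ∧ s (k + 1) = s m then (1 : ℝ) else 0) := by
  rw [backwardComparisons, backward, backwardOuter_snd (n - 1) 1 (by simp),
    Nat.add_sub_cancel' hn, Nat.cast_sum]
  refine Finset.sum_congr rfl fun k _ => ?_
  by_cases h : Set.InjOn s (Set.Icc 1 k)
  · simp only [h, if_true, true_and, mul_ite, mul_one, mul_zero, backwardInner_snd (k + 1) h]
  · simp [h]

/-! ### Probabilities of the events and the expectation -/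

variable {Ω : Type*} [MeasurableSpace Ω] {μ : Measure Ω}

/-- Split by the value v of g(Y): independence of X and Y gives each piece the factor P(X = v) =
1/n. Below, Y is the prefix, X the next entry and g a coordinate. -/
lemma measureReal_preimage_inter_eq_div [IsProbabilityMeasure μ] {β : Type*} [MeasurableSpace β]
    [DiscreteMeasurableSpace β] {n : ℕ} {X : Ω → ℕ} {Y : Ω → β} (hX : Measurable X)
    (hY : Measurable Y) (hXY : IndepFun Y X μ) (hlaw : μ.map X = uniformOn (Set.Icc 1 n))
    (g : β → ℕ) (hg : ∀ᵐ ω ∂μ, g (Y ω) ∈ Finset.Icc 1 n) (D : Set β) :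
    μ.real (Y ⁻¹' D ∩ {ω | X ω = g (Y ω)}) = μ.real (Y ⁻¹' D) / n := by
  have hD (E : Set β) : MeasurableSet (Y ⁻¹' E) := hY (MeasurableSet.of_discrete)
  have hXv (v : ℕ) : MeasurableSet (X ⁻¹' {v}) := hX (MeasurableSet.of_discrete)
  have hprob : ∀ v ∈ Finset.Icc 1 n, μ.real (X ⁻¹' {v}) = 1 / n := by
    intro v hv
    rw [measureReal_def, ← Measure.map_apply hX (measurableSet_singleton v), hlaw]
    have h := uniformOn_apply_finset (s := Finset.Icc 1 n) (t := {v})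
    rw [Finset.coe_singleton, Finset.coe_Icc, Finset.inter_singleton_of_mem hv] at h
    rw [h]
    simp
  have h1 : μ.real (Y ⁻¹' D ∩ {ω | X ω = g (Y ω)}) =
      ∑ v ∈ Finset.Icc 1 n, μ.real (Y ⁻¹' (D ∩ g ⁻¹' {v}) ∩ X ⁻¹' {v}) := by
    rw [← measureReal_biUnion_finset]
    · refine measureReal_congr (eventuallyEq_set.2 ?_)
      filter_upwards [hg] with ω hω
      simp only [Set.mem_inter_iff, Set.mem_preimage, Set.mem_ofPred_eq, Set.mem_iUnion,
        Set.mem_singleton_iff, exists_prop]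
      constructor
      · rintro ⟨ha, hb⟩
        exact ⟨_, hω, ⟨ha, rfl⟩, hb⟩
      · rintro ⟨v, -, ⟨ha, rfl⟩, hb⟩
        exact ⟨ha, hb⟩
    · intro v _ w _ hvw
      refine Set.disjoint_left.2 fun ω h h' => hvw ?_
      exact h.2.symm.trans h'.2
    · exact fun v _ => (hD _).inter (hXv v)
  have h2 : μ.real (Y ⁻¹' D) = ∑ v ∈ Finset.Icc 1 n, μ.real (Y ⁻¹' (D ∩ g ⁻¹' {v})) := by
    rw [← measureReal_biUnion_finset]
    · refine measureReal_congr (eventuallyEq_set.2 ?_)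
      filter_upwards [hg] with ω hω
      simp only [Set.mem_inter_iff, Set.mem_preimage, Set.mem_iUnion,
        Set.mem_singleton_iff, exists_prop]
      constructor
      · intro ha
        exact ⟨_, hω, ha, rfl⟩
      · rintro ⟨v, -, ha, -⟩
        exact ha
    · intro v _ w _ hvw
      refine Set.disjoint_left.2 fun ω h h' => hvw ?_
      exact h.2.symm.trans h'.2
    · exact fun v _ => hD _
  rw [h1, h2, Finset.sum_div]
  refine Finset.sum_congr rfl fun v hv => ?_
  rw [measureReal_def, hXY.measure_inter_preimage_eq_mul _ _ MeasurableSet.of_discrete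
    MeasurableSet.of_discrete, ENNReal.toReal_mul, ← measureReal_def, ← measureReal_def,
    hprob v hv]
  ring

namespace IsUniformInput

variable {n : ℕ} {x : ℕ → Ω → ℕ}

lemma ae_mem (hx : IsUniformInput μ n x) {i : ℕ} (hi : i ∈ Finset.Icc 1 n) :
    ∀ᵐ ω ∂μ, x i ω ∈ Finset.Icc 1 n := by
  have h : ∀ᵐ v ∂(μ.map (x i)), v ∈ Finset.Icc 1 n := by
    rw [hx.uniform i hi, ae_iff]
    rw [uniformOn_eq_zero_iff (Set.finite_Icc 1 n)]
    ext v
    simp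
  exact ae_of_ae_map (hx.measurable i hi).aemeasurable h

/-- The event that the first `k` entries are pairwise different. -/
def distinctEvent {α : Type*} (x : ℕ → α → ℕ) (k : ℕ) : Set α :=
  {ω | Set.InjOn (fun i => x i ω) (Set.Icc 1 k)}

lemma distinctEvent_eq_preimage {α : Type*} (x : ℕ → α → ℕ) {k : ℕ} (hk : k ≤ n) :
    distinctEvent x k = (fun ω (i : Finset.univ.filter fun i : Finset.Icc 1 n => i.1 ≤ k) =>
      x i ω) ⁻¹' {y | Function.Injective y} := by
  ext ω
  constructor
  · intro h i j hij
    have hi := (Finset.mem_filter.1 i.2).2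
    have hj := (Finset.mem_filter.1 j.2).2
    exact Subtype.ext (Subtype.ext (h ⟨(Finset.mem_Icc.1 i.1.2).1, hi⟩
      ⟨(Finset.mem_Icc.1 j.1.2).1, hj⟩ hij))
  · intro h i hi j hj hij
    have := @h ⟨⟨i, Finset.mem_Icc.2 ⟨hi.1, hi.2.trans hk⟩⟩, by simpa using hi.2⟩
      ⟨⟨j, Finset.mem_Icc.2 ⟨hj.1, hj.2.trans hk⟩⟩, by simpa using hj.2⟩ hij
    exact congrArg (fun i => i.1.1) this

lemma measurable_prefix (hx : IsUniformInput μ n x) (k : ℕ) :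
    Measurable (fun ω (i : Finset.univ.filter fun i : Finset.Icc 1 n => i.1 ≤ k) => x i ω) :=
  measurable_pi_lambda _ fun i => hx.measurable i.1 i.1.2

lemma measurableSet_distinctEvent (hx : IsUniformInput μ n x) {k : ℕ} (hk : k ≤ n) :
    MeasurableSet (distinctEvent x k) := by
  rw [distinctEvent_eq_preimage x hk]
  exact hx.measurable_prefix k MeasurableSet.of_discrete

lemma measureReal_distinctEvent_inter [IsProbabilityMeasure μ] (hx : IsUniformInput μ n x)
    {k m : ℕ} (hk : k < n) (hm : m ∈ Finset.Icc 1 k) :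
    μ.real (distinctEvent x k ∩ {ω | x (k + 1) ω = x m ω}) = μ.real (distinctEvent x k) / n := by
  rw [Finset.mem_Icc] at hm
  have hmn : m ∈ Finset.Icc 1 n := Finset.mem_Icc.2 ⟨hm.1, hm.2.trans hk.le⟩
  have hkn : k + 1 ∈ Finset.Icc 1 n := Finset.mem_Icc.2 ⟨by omega, hk⟩
  have hind := hx.indep.indepFun_finset (Finset.univ.filter fun i => i.1 ≤ k) {⟨k + 1, hkn⟩}
    (by simp) fun i => hx.measurable i i.2
  have hind' := hind.comp measurable_id
    (measurable_pi_apply (⟨⟨k + 1, hkn⟩, Finset.mem_singleton_self _⟩ :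
      ({⟨k + 1, hkn⟩} : Finset (Finset.Icc 1 n))))
  rw [distinctEvent_eq_preimage x hk.le]
  exact measureReal_preimage_inter_eq_div (hx.measurable _ hkn) (hx.measurable_prefix k) hind'
    (hx.uniform _ hkn) (fun y => y ⟨⟨m, hmn⟩, by simpa using hm.2⟩) (hx.ae_mem hmn) _

lemma measurableSet_eq (hx : IsUniformInput μ n x) {i j : ℕ} (hi : i ∈ Finset.Icc 1 n)
    (hj : j ∈ Finset.Icc 1 n) : MeasurableSet {ω | x i ω = x j ω} :=
  measurableSet_eq_fun (hx.measurable i hi) (hx.measurable j hj)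

lemma measureReal_distinctEvent [IsProbabilityMeasure μ] (hx : IsUniformInput μ n x)
    (hn : 1 ≤ n) {k : ℕ} (hk : k ≤ n) : μ.real (distinctEvent x k) = distinctProb n k := by
  induction k with
  | zero =>
    have : distinctEvent x 0 = Set.univ := Set.eq_univ_of_forall fun ω => by
      simp [distinctEvent]
    rw [this]
    simp
  | succ k ih =>
    have ih := ih (by omega)
    have hm : ∀ m ∈ Finset.Icc 1 k,
        MeasurableSet (distinctEvent x k ∩ {ω | x (k + 1) ω = x m ω}) := fun m hm => by
      rw [Finset.mem_Icc] at hm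
      exact (hx.measurableSet_distinctEvent (by omega)).inter
        (hx.measurableSet_eq (Finset.mem_Icc.2 ⟨by omega, hk⟩)
          (Finset.mem_Icc.2 ⟨hm.1, by omega⟩))
    -- The removed events are disjoint, since a prefix with distinct entries matches the new entry
    -- at most once. Each has probability p_k/n, leaving p_k (1 - k/n).
    have hset : distinctEvent x (k + 1) = distinctEvent x k \
        ⋃ m ∈ Finset.Icc 1 k, distinctEvent x k ∩ {ω | x (k + 1) ω = x m ω} := by
      ext ω
      have := injOn_Icc_succ_iff (fun i => x i ω) k
      simp only [distinctEvent, Set.mem_sdiff, Set.mem_ofPred_eq, Set.mem_iUnion,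
        Set.mem_inter_iff, exists_prop] at this ⊢
      rw [this]
      exact and_congr_right fun h => by simp only [h, true_and]
    rw [hset, measureReal_sdiff (Set.iUnion₂_subset fun m _ => Set.inter_subset_left)
      (Finset.measurableSet_biUnion (Finset.Icc 1 k) hm), measureReal_biUnion_finset ?_ hm,
      Finset.sum_congr rfl fun m hm => hx.measureReal_distinctEvent_inter hk hm, ih,
      distinctProb_succ hn]
    · simp
      ring
    · intro a ha b hb hab
      refine Set.disjoint_left.2 fun ω h h' => hab ?_
      have ha := Finset.mem_Icc.1 ha
      have hb := Finset.mem_Icc.1 hb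
      exact h.1 ha hb (h.2.symm.trans h'.2)

lemma backwardComparisons_eq_sum_indicator {α : Type*} (x : ℕ → α → ℕ) (hn : 1 ≤ n) :
    (fun ω => (backwardComparisons n (fun i => x i ω) : ℝ)) = fun ω => ∑ k ∈ Finset.Ico 1 n,
      ((distinctEvent x k).indicator (fun _ => (k : ℝ)) ω - ∑ m ∈ Finset.Icc 1 k, (m - 1 : ℝ) *
        (distinctEvent x k ∩ {ω | x (k + 1) ω = x m ω}).indicator (fun _ => (1 : ℝ)) ω) := by
  classical
  funext ω
  rw [backwardComparisons_eq hn]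
  simp only [Set.indicator_apply, Set.mem_inter_iff, distinctEvent, Set.mem_ofPred_eq]

lemma hasIntegral_backwardComparisons [IsProbabilityMeasure μ] (hx : IsUniformInput μ n x)
    (hn : 1 ≤ n) :
    Integrable (fun ω => (backwardComparisons n (fun i => x i ω) : ℝ)) μ ∧
      ∫ ω, (backwardComparisons n (fun i => x i ω) : ℝ) ∂μ =
        (n : ℝ) - √(Real.pi * n / 8) + 2 / 3 - alpha n := by
  have hA : ∀ k ∈ Finset.Ico 1 n, MeasurableSet (distinctEvent x k) := fun k hk =>
    hx.measurableSet_distinctEvent (Finset.mem_Ico.1 hk).2.le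
  have hB : ∀ k ∈ Finset.Ico 1 n, ∀ m ∈ Finset.Icc 1 k,
      MeasurableSet (distinctEvent x k ∩ {ω | x (k + 1) ω = x m ω}) := by
    intro k hk m hm
    have hk' := Finset.mem_Ico.1 hk
    have hm' := Finset.mem_Icc.1 hm
    exact (hA k hk).inter (hx.measurableSet_eq (Finset.mem_Icc.2 ⟨by omega, hk'.2⟩)
      (Finset.mem_Icc.2 ⟨hm'.1, by omega⟩))
  have iA : ∀ k ∈ Finset.Ico 1 n,
      Integrable ((distinctEvent x k).indicator fun _ => (k : ℝ)) μ := fun k hk =>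
    (integrable_const _).indicator (hA k hk)
  have iB : ∀ k ∈ Finset.Ico 1 n, ∀ m ∈ Finset.Icc 1 k, Integrable (fun ω => (m - 1 : ℝ) *
      (distinctEvent x k ∩ {ω | x (k + 1) ω = x m ω}).indicator (fun _ => (1 : ℝ)) ω) μ :=
    fun k hk m hm => ((integrable_const _).indicator (hB k hk m hm)).const_mul _
  rw [backwardComparisons_eq_sum_indicator x hn]
  have iAB : ∀ k ∈ Finset.Ico 1 n, Integrable (fun ω =>
      (distinctEvent x k).indicator (fun _ => (k : ℝ)) ω - ∑ m ∈ Finset.Icc 1 k, (m - 1 : ℝ) *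
        (distinctEvent x k ∩ {ω | x (k + 1) ω = x m ω}).indicator (fun _ => (1 : ℝ)) ω) μ :=
    fun k hk => (iA k hk).sub (integrable_finsetSum _ (iB k hk))
  refine ⟨integrable_finsetSum _ iAB, ?_⟩
  rw [integral_finsetSum _ iAB,
    ← sum_expected_comparisons hn, Finset.range_eq_Ico, Finset.sum_eq_sum_Ico_succ_bot hn]
  simp only [Nat.cast_zero, zero_mul, zero_div, sub_zero, mul_zero, zero_add]
  refine Finset.sum_congr rfl fun k hk => ?_
  have hkn := (Finset.mem_Ico.1 hk).2
  have hsum : ∑ m ∈ Finset.Icc 1 k, (m - 1 : ℝ) = k * (k - 1) / 2 := by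
    clear hk hkn
    induction k with
    | zero => simp
    | succ k ih =>
      rw [Finset.sum_Icc_succ_top (by omega), ih]
      push_cast
      ring
  rw [integral_sub (iA k hk) (integrable_finsetSum _ (iB k hk)), integral_finsetSum _ (iB k hk),
    integral_indicator_const _ (hA k hk), hx.measureReal_distinctEvent hn hkn.le,
    Finset.sum_congr rfl fun m hm => by
      rw [integral_const_mul, integral_indicator_const _ (hB k hk m hm),
        hx.measureReal_distinctEvent_inter hkn hm, hx.measureReal_distinctEvent hn hkn.le,
        smul_eq_mul, mul_one],
    ← Finset.sum_mul, hsum, smul_eq_mul]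
  have hn0 : (n : ℝ) ≠ 0 := by positivity
  field_simp

end IsUniformInput

end LatinTest

theorem theorem12 :
    (∀ (n : ℕ), 1 ≤ n →
      ∀ (Ω : Type*) [MeasurableSpace Ω] (μ : Measure Ω) [IsProbabilityMeasure μ]
        (x : ℕ → Ω → ℕ), LatinTest.IsUniformInput μ n x →
        Integrable (fun ω => (LatinTest.backwardComparisons n (fun i => x i ω) : ℝ)) μ ∧
        (∫ ω, (LatinTest.backwardComparisons n (fun i => x i ω) : ℝ) ∂μ
          = (n : ℝ) - Real.sqrt (Real.pi * n / 8) + 2 / 3 - 1 / 2 * LatinTest.kappa n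
              - (n.factorial : ℝ) / (n : ℝ) ^ n * (((n : ℝ) + 1) / 2)) ∧
        (∫ ω, (LatinTest.backwardComparisons n (fun i => x i ω) : ℝ) ∂μ
          = (n : ℝ) - Real.sqrt (Real.pi * n / 8) + 2 / 3 - LatinTest.alpha n)) ∧
    StrictAntiOn LatinTest.alpha (Set.Ici 1) ∧
    Tendsto LatinTest.alpha atTop (𝓝 0) := by
  refine ⟨fun n hn Ω _ μ _ x hx => ?_, LatinTest.strictAntiOn_alpha, LatinTest.tendsto_alpha⟩
  obtain ⟨hint, hval⟩ := hx.hasIntegral_backwardComparisons hn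
  refine ⟨hint, ?_, hval⟩
  rw [hval, LatinTest.alpha]
  ring
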